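/- All graphs are finite and simple. A \emph{hole} of a graph $G$ is an induced cycle of $G$ of length at least $4$. A vertex $u$ of $G$ satisfies the \emph{NC property} if no hole containing $u$ shares two consecutive edges (two distinct edges with a common end) with a hole not containing $u$. A \emph{hole cover} of $G$ is a nonempty set $C \subseteq V(G)$ such that every hole of $G$ contains a vertex of $C$; it satisfies the NC property in $G$ if every vertex of $C$ satisfies the NC property and every hole of $G$ contains at most one vertex of $C$. The graph $G$ has the NC property if it has a hole cover satisfying the NC property in $G$. A correspondence assignment of $G$ gives each vertex $v$ a finite list $L(v)$ of colors and each edge $uv$ a (possibly empty, not necessarily perfect) matching $M_{uv}$ between $\{u\}\times L(u)$ and $\{v\}\times L(v)$. The DP-chromatic number $\chi_{DP}(G)$ is the least $k$ such that for every correspondence assignment with $|L(v)| \ge k$ for all $v$ there is a choice of colors $\varphi(v) \in L(v)$, $v \in V(G)$, with $(u,\varphi(u))(v,\varphi(v)) \notin M_{uv}$ for every edge $uv$. Let $\omega(G)$ be the clique number of $G$. \textbf{Theorem.} Let $G$ be a graph with the NC property. Then $\chi_{DP}(G) \le \omega(G) + 1$. Moreover, for every positive integer $n$, if $G$ is $K_n$-minor-free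 (that is, $K_n$ is not a minor of $G$), then $\chi_{DP}(G) \le n-1$. -/

import Mathlib

namespace SimpleGraph

/-- A hole of `G`: an induced subgraph of `G` which is a cycle of length at least `4`. -/
def IsHole {V : Type*} (G : SimpleGraph V) (H : G.Subgraph) : Prop :=
  H.IsInduced ∧ ∃ n : ℕ, 4 ≤ n ∧ Nonempty (H.coe ≃g cycleGraph n)

/-- A hole cover of `G`: a nonempty set of vertices that meets every hole of `G`. -/
def IsHoleCover {V : Type*} (G : SimpleGraph V) (X : Set V) : Prop :=
  X.Nonempty ∧ ∀ H : G.Subgraph, G.IsHole H → ∃ x ∈ X, x ∈ H.verts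

/-- Two subgraphs share consecutive edges: there are two distinct edges `xy` and `yz` with a
common end that lie on both of them. -/
def ShareConsecutiveEdges {V : Type*} (G : SimpleGraph V) (H₁ H₂ : G.Subgraph) : Prop :=
  ∃ x y z : V, x ≠ z ∧ (H₁.Adj x y ∧ H₁.Adj y z) ∧ (H₂.Adj x y ∧ H₂.Adj y z)

/-- The vertex `u` satisfies the non-consecutive property: no hole through `u` shares consecutive
edges with a hole that avoids `u`. -/
def VertexNC {V : Type*} (G : SimpleGraph V) (u : V) : Prop :=
  ∀ H₁ H₂ : G.Subgraph, G.IsHole H₁ → G.IsHole H₂ → u ∈ H₁.verts → u ∉ H₂.verts →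
    ¬ G.ShareConsecutiveEdges H₁ H₂

/-- The vertex set `C` satisfies the NC property in `G`: each of its vertices does, and every
hole contains at most one vertex of `C`. -/
def SetNC {V : Type*} (G : SimpleGraph V) (C : Set V) : Prop :=
  (∀ u ∈ C, G.VertexNC u) ∧
    ∀ H : G.Subgraph, G.IsHole H → (H.verts ∩ C).Subsingleton

/-- The graph `G` satisfies the NC property: it has a hole cover satisfying the NC property. -/
def HasNCProperty {V : Type*} (G : SimpleGraph V) : Prop :=
  ∃ C : Set V, G.IsHoleCover C ∧ G.SetNC C

/-- `K` is a minor of `G`, given by branch sets: pairwise disjoint sets of vertices of `G`, one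
for each vertex of `K`, that are nonempty and connected in `G`, with an edge of `G` between any
two that correspond to adjacent vertices of `K`. -/
def IsMinor {W V : Type*} (K : SimpleGraph W) (G : SimpleGraph V) : Prop :=
  ∃ B : W → Set V,
    (∀ a, (G.induce (B a)).Connected) ∧
    (∀ a b, a ≠ b → Disjoint (B a) (B b)) ∧
    ∀ a b, K.Adj a b → ∃ x ∈ B a, ∃ y ∈ B b, G.Adj x y

/-- A correspondence assignment (DP-cover) of `G`: a list of colors for every vertex and, for
every edge `uv`, a (partial) matching between the colors of `u` and those of `v`;
`Matched u v a b` says that the color `a` of `u` is matched with the color `b` of `v`. -/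
structure CorrespondenceAssignment {V : Type*} (G : SimpleGraph V) where
  list : V → Finset ℕ
  Matched : V → V → ℕ → ℕ → Prop
  adj : ∀ ⦃u v a b⦄, Matched u v a b → G.Adj u v
  mem : ∀ ⦃u v a b⦄, Matched u v a b → a ∈ list u ∧ b ∈ list v
  symm : ∀ ⦃u v a b⦄, Matched u v a b → Matched v u b a
  unique : ∀ ⦃u v a b c⦄, Matched u v a b → Matched u v a c → b = c

/-- `G` is DP-`k`-colorable: for every correspondence assignment with lists of at least `k`
colors one can choose from each list a color such that the colors of adjacent vertices are
never matched. -/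
def DPColorable {V : Type*} (G : SimpleGraph V) (k : ℕ) : Prop :=
  ∀ C : G.CorrespondenceAssignment, (∀ v, k ≤ (C.list v).card) →
    ∃ φ : V → ℕ, (∀ v, φ v ∈ C.list v) ∧ ∀ u v, G.Adj u v → ¬ C.Matched u v (φ u) (φ v)

/-- The DP-chromatic number: the least `k` such that `G` is DP-`k`-colorable (`⊤` if there is
none). -/
noncomputable def dpChromaticNumber {V : Type*} (G : SimpleGraph V) : ℕ∞ :=
  ⨅ k ∈ {k : ℕ | G.DPColorable k}, (k : ℕ∞)

end SimpleGraph

/-!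
The upper bounds come from degeneracy. If every nonempty set `W` of vertices contains a vertex with
fewer than `k` neighbors in `W`, then greedy coloring shows that the graph is DP-`k`-colorable
(`dpColorable_of_degenerate`). It therefore suffices to find in every `W` a vertex `v` whose
neighborhood in `W` is almost a clique (`IsAlmostSimplicial`): one neighbor `u` may fail to be
adjacent to the others, but then `u` can be enlarged to a connected set that is adjacent to all of
them and avoids the rest of the closed neighborhood. Such a `v` has at most `ω(G)` neighbors in `W`,
and together with its neighborhood it gives the branch sets of a complete minor with one vertex more
than `v` has neighbors.

The NC property concerns only the holes of `G`, so it is available inside every `W`. An induction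
over clique cutsets (`exists_of_noCliqueCutset`), in the manner of Dirac's proof that chordal graphs
have simplicial vertices, reduces the search for `v` to sets `W` without clique cutset. The heart of
the matter is that all holes in such a `W` have a common vertex `u`
(`IsNCCover.exists_forall_mem`). Then `W` without `u` is chordal and has a simplicial vertex `v`;
if `v` is adjacent to `u`, then deleting `v` and its other neighbors leaves a connected set around
`u` adjacent to each of these neighbors, because otherwise there would be a clique cutset.

For the existence of `u`, take any `u` in the hole cover `C` that lies on a hole in `W`. Let `U` be
the union of the holes through `u`, and `Z` the set of the other neighbors of `u`.
* All neighbors of `u` attach to one component of the non-neighbors of `u`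
  (`IsNCCover.exists_adj_comp`). Hence nonadjacent neighbors of `u` lie on a common hole with `u`,
  so `Z` is a clique; also `Z` is completely joined to `U` (`IsNCCover.adj_of_mem_hole`).
* A hole inside `U` meets `C` in a vertex on a common hole with `u`, hence in `u`. So `U` without
  `u` is chordal. If a component `D` of the rest of `W` had two nonadjacent neighbors in `U`, then a
  clique separating them in `U` without `u` would yield a hole through `u` and `D`
  (`exists_isHoleSet_through`), contrary to the choice of `U`. So the neighbors of `D` form a
  clique, which would be a clique cutset. Hence `W = U ∪ Z`.
* A hole in `W` has no vertex in `Z`, as such a vertex is adjacent to all others. So it lies in `U`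
  and contains `u`.
-/

namespace SimpleGraph

variable {V : Type*} (G : SimpleGraph V)

/-! ### Connectivity inside a vertex set -/

/-- `G.ReachIn X a b`: the vertex `b` can be reached from `a` along edges of `G` with both ends
in `X`. Every vertex reaches itself, also outside of `X`. -/
def ReachIn (X : Set V) (a b : V) : Prop :=
  Relation.ReflTransGen (fun x y => x ∈ X ∧ y ∈ X ∧ G.Adj x y) a b

/-- The vertices reached from `a` inside `X`: for `a ∈ X`, the vertex set of the connected
component of `a` in the subgraph induced by `X`. -/
def compIn (X : Set V) (a : V) : Set V := {b | G.ReachIn X a b}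

variable {G}

lemma ReachIn.symm {X : Set V} {a b : V} (h : G.ReachIn X a b) : G.ReachIn X b a := by
  induction h with
  | refl => exact .refl
  | tail _ h ih => exact Relation.ReflTransGen.head ⟨h.2.1, h.1, h.2.2.symm⟩ ih

lemma ReachIn.trans {X : Set V} {a b c : V} (h : G.ReachIn X a b) (h' : G.ReachIn X b c) :
    G.ReachIn X a c :=
  Relation.ReflTransGen.trans h h'

lemma ReachIn.mono {X Y : Set V} (hXY : X ⊆ Y) {a b : V} (h : G.ReachIn X a b) :
    G.ReachIn Y a b := by
  induction h with
  | refl => exact .refl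
  | tail _ h ih => exact Relation.ReflTransGen.tail ih ⟨hXY h.1, hXY h.2.1, h.2.2⟩

lemma ReachIn.of_adj {X : Set V} {a b : V} (ha : a ∈ X) (hb : b ∈ X) (h : G.Adj a b) :
    G.ReachIn X a b :=
  Relation.ReflTransGen.single ⟨ha, hb, h⟩

lemma mem_compIn_self (X : Set V) (a : V) : a ∈ G.compIn X a := Relation.ReflTransGen.refl

lemma compIn_subset {X : Set V} {a : V} (ha : a ∈ X) : G.compIn X a ⊆ X := by
  intro b hb
  induction hb with
  | refl => exact ha
  | tail _ h _ => exact h.2.1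

lemma mem_compIn_of_adj {X : Set V} {a b c : V} (ha : a ∈ X) (hb : b ∈ G.compIn X a) (hc : c ∈ X)
    (h : G.Adj b c) : c ∈ G.compIn X a :=
  ReachIn.trans hb (.of_adj (compIn_subset ha hb) hc h)

/-- A set that contains `a` and is closed under adjacency inside `X` contains everything reached
from `a` inside `X`. -/
lemma ReachIn.mem_of_closed {X Y : Set V} {a b : V} (h : G.ReachIn X a b) (ha : a ∈ Y)
    (hY : ∀ x ∈ Y, ∀ y ∈ X, G.Adj x y → y ∈ Y) : b ∈ Y := by
  induction h with
  | refl => exact ha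
  | tail _ h ih => exact hY _ ih _ h.2.1 h.2.2

/-- Components are connected within themselves. -/
lemma reachIn_compIn {X : Set V} {a b c : V} (hb : b ∈ G.compIn X a)
    (hc : c ∈ G.compIn X a) : G.ReachIn (G.compIn X a) b c := by
  have key : ∀ d ∈ G.compIn X a, G.ReachIn (G.compIn X a) a d := by
    intro d hd
    induction hd with
    | refl => exact .refl
    | @tail x y h h' ih =>
      exact ih.trans (.of_adj h (Relation.ReflTransGen.tail h h') h'.2.2)
  exact (key b hb).symm.trans (key c hc)

/-- On the way from a vertex outside of `P` to one in `P` there is a first vertex in `P`. -/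
lemma ReachIn.exists_first {X P : Set V} {a b : V} (h : G.ReachIn X a b) (ha : a ∉ P)
    (hb : b ∈ P) : ∃ c d, G.ReachIn (X \ P) a c ∧ c ∉ P ∧ d ∈ X ∧ d ∈ P ∧ G.Adj c d := by
  induction h using Relation.ReflTransGen.head_induction_on with
  | refl => exact absurd hb ha
  | @head x y hxy _ ih =>
    by_cases hy : y ∈ P
    · exact ⟨x, y, .refl, ha, hxy.2.1, hy, hxy.2.2⟩
    · obtain ⟨c, d, hc, h⟩ := ih hy
      exact ⟨c, d, (ReachIn.of_adj (G := G) (X := X \ P) ⟨hxy.1, ha⟩ ⟨hxy.2.1, hy⟩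
        hxy.2.2).trans hc, h⟩

/-! ### Induced paths -/

/-- The vertices `p 0, …, p n` form an induced path of `G` in this order; the values of `p` beyond
`n` are irrelevant. -/
structure IsIndPath (G : SimpleGraph V) (n : ℕ) (p : ℕ → V) : Prop where
  inj : ∀ i j, i ≤ n → j ≤ n → p i = p j → i = j
  adj : ∀ i j, i ≤ n → j ≤ n → (G.Adj (p i) (p j) ↔ i + 1 = j ∨ j + 1 = i)

lemma ReachIn.exists_seq {X : Set V} {a b : V} (h : G.ReachIn X a b) (ha : a ∈ X) :
    ∃ (n : ℕ) (p : ℕ → V), p 0 = a ∧ p n = b ∧ (∀ i, i ≤ n → p i ∈ X) ∧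
      ∀ i, i < n → G.Adj (p i) (p (i + 1)) := by
  induction h with
  | refl => exact ⟨0, fun _ => a, rfl, rfl, fun _ _ => ha, fun i hi => absurd hi (by omega)⟩
  | @tail x y _ hxy ih =>
    obtain ⟨n, p, h0, hn, hX, hadj⟩ := ih
    refine ⟨n + 1, fun i => if i ≤ n then p i else y, by simpa using h0, by simp, ?_, ?_⟩
    · intro i _
      by_cases hi : i ≤ n
      · simpa [hi] using hX i hi
      · simpa [hi] using hxy.2.1
    · intro i hi
      rcases Nat.lt_or_ge i n with h | h
      · simpa [h.le, Nat.succ_le_of_lt h] using hadj i h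
      · obtain rfl : i = n := by omega
        simpa [hn] using hxy.2.2

/-- Two distinct nonadjacent vertices with neighbors in a connected set `E` are joined by an induced
path with interior in `E`: a shortest such path. -/
lemma exists_indPath {E : Set V} {x y e f : V} (hxy : x ≠ y) (hnadj : ¬ G.Adj x y)
    (he : e ∈ E) (hxe : G.Adj x e) (hfy : G.Adj f y) (hef : G.ReachIn E e f) :
    ∃ (n : ℕ) (p : ℕ → V), 2 ≤ n ∧ G.IsIndPath n p ∧ p 0 = x ∧ p n = y ∧
      ∀ i, 0 < i → i < n → p i ∈ E := by
  classical
  let Q : ℕ → Prop := fun n => ∃ p : ℕ → V, p 0 = x ∧ p n = y ∧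
    (∀ i, 0 < i → i < n → p i ∈ E) ∧ ∀ i, i < n → G.Adj (p i) (p (i + 1))
  have hQ : ∃ n, Q n := by
    obtain ⟨n, p, h0, hn, hX, hadj⟩ := hef.exists_seq he
    refine ⟨n + 2, fun i => if i = 0 then x else if i ≤ n + 1 then p (i - 1) else y, by simp,
      by simp, ?_, ?_⟩
    · intro i hi hi'
      simpa [hi.ne', show i ≤ n + 1 by omega] using hX (i - 1) (by omega)
    · intro i hi
      rcases Nat.eq_zero_or_pos i with rfl | h
      · simpa [h0] using hxe
      · rcases Nat.lt_or_ge i (n + 1) with h' | h'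
        · have := hadj (i - 1) (by omega)
          rw [Nat.sub_add_cancel h] at this
          simpa [h.ne', h'.le, Nat.succ_le_of_lt h', show i ≤ n by omega] using this
        · obtain rfl : i = n + 1 := by omega
          simpa [hn] using hfy
  obtain ⟨p, h0, hn, hE, hadj⟩ := Nat.find_spec hQ
  set n := Nat.find hQ with hndef
  have hmin : ∀ m, m < n → ¬ Q m := fun m hm => Nat.find_min hQ hm
  have hn2 : 2 ≤ n := by
    by_contra hlt
    have : n = 0 ∨ n = 1 := by omega
    rcases this with h | h
    · rw [h] at hn
      exact hxy (h0.symm.trans hn)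
    · have := hadj 0 (by omega)
      rw [h] at hn
      rw [h0, zero_add, hn] at this
      exact hnadj this
  -- a coincidence or a chord would allow cutting out the part between `i` and `j`
  have cut : ∀ i j k, i < j → j ≤ n → j = i + k → 1 ≤ k → p i ≠ p j := by
    intro i j k hij hj hk hk1 heq
    refine hmin (n - k) (by omega) ⟨fun l => if l ≤ i then p l else p (l + k), by simpa using h0,
      ?_, ?_, ?_⟩
    · by_cases h : n - k ≤ i
      · have h1 : n - k = i := by omega
        have h2 : j = n := by omega
        simp [h1, heq, h2, hn]
      · simp [h, show n - k + k = n by omega, hn]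
    · intro l hl hl'
      by_cases h : l ≤ i
      · simpa [h] using hE l hl (by omega)
      · simpa [h] using hE (l + k) (by omega) (by omega)
    · intro l hl
      by_cases h : l + 1 ≤ i
      · simpa [h, show l ≤ i by omega] using hadj l (by omega)
      · by_cases h' : l ≤ i
        · obtain rfl : l = i := by omega
          have := hadj j (by omega)
          rw [← heq, hk] at this
          simpa [show l + 1 + k = l + k + 1 by omega] using this
        · have := hadj (l + k) (by omega)
          simpa [h, h', show l + 1 + k = l + k + 1 by omega] using this
  have cut' : ∀ i j k, j = i + 1 + k → 1 ≤ k → j ≤ n → ¬ G.Adj (p i) (p j) := by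
    intro i j k hk hk1 hj ha
    refine hmin (n - k) (by omega) ⟨fun l => if l ≤ i then p l else p (l + k), by simpa using h0,
      ?_, ?_, ?_⟩
    · simp [show ¬ n - k ≤ i by omega, show n - k + k = n by omega, hn]
    · intro l hl hl'
      by_cases h : l ≤ i
      · simpa [h] using hE l hl (by omega)
      · simpa [h] using hE (l + k) (by omega) (by omega)
    · intro l hl
      by_cases h : l + 1 ≤ i
      · simpa [h, show l ≤ i by omega] using hadj l (by omega)
      · by_cases h' : l ≤ i
        · obtain rfl : l = i := by omega
          simpa [← hk] using ha
        · have := hadj (l + k) (by omega)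
          simpa [h, h', show l + 1 + k = l + k + 1 by omega] using this
  refine ⟨n, p, hn2, ⟨?_, ?_⟩, h0, hn, hE⟩
  · intro i j hi hj h
    rcases lt_trichotomy i j with hlt | heq | hlt
    · exact absurd h (cut i j (j - i) hlt hj (by omega) (by omega))
    · exact heq
    · exact absurd h.symm (cut j i (i - j) hlt hi (by omega) (by omega))
  · intro i j hi hj
    constructor
    · intro ha
      by_contra hne
      push Not at hne
      rcases lt_trichotomy i j with hlt | heq | hlt
      · exact cut' i j (j - i - 1) (by omega) (by omega) hj ha
      · exact ha.ne (by rw [heq])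
      · exact cut' j i (i - j - 1) (by omega) (by omega) hi ha.symm
    · rintro (rfl | rfl)
      · exact hadj i (by omega)
      · exact (hadj j (by omega)).symm

/-! ### Holes as vertex sets -/

/-- `S` is the vertex set of a hole of `G`: it is listed without repetition by `f 0, …, f (n - 1)`,
where `4 ≤ n`, and two of these vertices are adjacent exactly if they are cyclically consecutive. -/
def IsHoleSet (G : SimpleGraph V) (S : Set V) : Prop :=
  ∃ (n : ℕ) (f : ℕ → V), 4 ≤ n ∧ (∀ v, v ∈ S ↔ ∃ i, i < n ∧ f i = v) ∧
    (∀ i j, i < n → j < n → f i = f j → i = j) ∧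
    ∀ i j, i < n → j < n → (G.Adj (f i) (f j) ↔
      i + 1 = j ∨ j + 1 = i ∨ (i = 0 ∧ j + 1 = n) ∨ (j = 0 ∧ i + 1 = n))

/-- Two induced paths with the same ends whose interiors are disjoint and without edges between them
form a hole. -/
lemma isHoleSet_of_indPaths {n m : ℕ} {p q : ℕ → V} (hp : G.IsIndPath n p)
    (hq : G.IsIndPath m q) (hn : 2 ≤ n) (hm : 2 ≤ m) (h0 : p 0 = q 0) (h1 : p n = q m)
    (hne : ∀ i j, 0 < i → i < n → 0 < j → j < m → p i ≠ q j ∧ ¬ G.Adj (p i) (q j)) :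
    G.IsHoleSet ({v | ∃ i, i ≤ n ∧ p i = v} ∪ {v | ∃ i, 0 < i ∧ i < m ∧ q i = v}) := by
  have hpq : ∀ i j, i ≤ n → 0 < j → j < m →
      p i ≠ q j ∧ (G.Adj (p i) (q j) ↔ (i = 0 ∧ j = 1) ∨ (i = n ∧ j + 1 = m)) := by
    intro i j hi hj hj'
    by_cases hi0 : i = 0
    · subst hi0
      rw [h0]
      refine ⟨fun h => ?_, ?_⟩
      · have := hq.inj _ _ (by omega) (by omega) h
        omega
      · rw [hq.adj _ _ (by omega) (by omega)]
        omega
    by_cases hin : i = n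
    · subst hin
      rw [h1]
      refine ⟨fun h => ?_, ?_⟩
      · have := hq.inj _ _ (by omega) (by omega) h
        omega
      · rw [hq.adj _ _ (by omega) (by omega)]
        omega
    · have := hne i j (by omega) (by omega) hj hj'
      refine ⟨this.1, iff_of_false this.2 (by omega)⟩
  -- run along `p`, then backwards through the interior of `q`
  refine ⟨n + m, fun i => if i ≤ n then p i else q (n + m - i), by omega, ?_, ?_, ?_⟩
  · intro v
    constructor
    · rintro (⟨i, hi, rfl⟩ | ⟨i, hi, hi', rfl⟩)
      · exact ⟨i, by omega, by simp [hi]⟩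
      · refine ⟨n + m - i, by omega, ?_⟩
        simp [show ¬ n + m - i ≤ n by omega, show n + m - (n + m - i) = i by omega]
    · rintro ⟨i, hi, rfl⟩
      by_cases h : i ≤ n
      · exact .inl ⟨i, h, by simp [h]⟩
      · exact .inr ⟨n + m - i, by omega, by omega, by simp [h]⟩
  · intro i j hi hj
    by_cases h : i ≤ n <;> by_cases h' : j ≤ n <;> simp only [h, h', if_true, if_false]
    · exact hp.inj i j h h'
    · exact fun e => absurd e (hpq i (n + m - j) h (by omega) (by omega)).1
    · exact fun e => absurd e.symm (hpq j (n + m - i) h' (by omega) (by omega)).1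
    · intro e
      have := hq.inj _ _ (by omega) (by omega) e
      omega
  · intro i j hi hj
    by_cases h : i ≤ n <;> by_cases h' : j ≤ n <;> simp only [h, h', if_true, if_false]
    · rw [hp.adj i j h h']
      omega
    · rw [(hpq i (n + m - j) h (by omega) (by omega)).2]
      omega
    · rw [G.adj_comm, (hpq j (n + m - i) h' (by omega) (by omega)).2]
      omega
    · rw [hq.adj _ _ (by omega) (by omega)]
      omega

/-- No vertex of a hole is adjacent to all others. -/
lemma IsHoleSet.exists_not_adj {S : Set V} (hS : G.IsHoleSet S) {u : V} (hu : u ∈ S) :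
    ∃ v ∈ S, v ≠ u ∧ ¬ G.Adj u v := by
  obtain ⟨n, f, hn, hmem, hinj, hadj⟩ := hS
  obtain ⟨i, hi, rfl⟩ := (hmem u).1 hu
  have key : ∀ j, j < n → j ≠ i → ¬ (i + 1 = j ∨ j + 1 = i ∨ (i = 0 ∧ j + 1 = n) ∨
      (j = 0 ∧ i + 1 = n)) → ∃ v ∈ S, v ≠ f i ∧ ¬ G.Adj (f i) v := fun j hj hji h =>
    ⟨f j, (hmem _).2 ⟨j, hj, rfl⟩, fun e => hji (hinj _ _ hj hi e), by rwa [hadj i j hi hj]⟩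
  by_cases h : i + 2 < n
  · exact key (i + 2) h (by omega) (by omega)
  · exact key (i - 2) (by omega) (by omega) (by omega)

lemma IsHoleSet.exists_neighbors {S : Set V} (hS : G.IsHoleSet S) {u : V} (hu : u ∈ S) :
    ∃ x ∈ S, ∃ y ∈ S, x ≠ y ∧ ¬ G.Adj x y ∧ G.Adj u x ∧ G.Adj u y := by
  obtain ⟨n, f, hn, hmem, hinj, hadj⟩ := hS
  obtain ⟨i, hi, rfl⟩ := (hmem u).1 hu
  have key : ∀ j k, j < n → k < n → j ≠ k → ¬ (k + 1 = j ∨ j + 1 = k ∨ (k = 0 ∧ j + 1 = n) ∨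
      (j = 0 ∧ k + 1 = n)) → (i + 1 = j ∨ j + 1 = i ∨ (i = 0 ∧ j + 1 = n) ∨
      (j = 0 ∧ i + 1 = n)) → (i + 1 = k ∨ k + 1 = i ∨ (i = 0 ∧ k + 1 = n) ∨
      (k = 0 ∧ i + 1 = n)) → ∃ x ∈ S, ∃ y ∈ S, x ≠ y ∧ ¬ G.Adj x y ∧ G.Adj (f i) x ∧
      G.Adj (f i) y := fun j k hj hk hjk h h1 h2 =>
    ⟨f j, (hmem _).2 ⟨j, hj, rfl⟩, f k, (hmem _).2 ⟨k, hk, rfl⟩,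
      fun e => hjk (hinj _ _ hj hk e), by rw [hadj j k hj hk]; omega,
      by rwa [hadj i j hi hj], by rwa [hadj i k hi hk]⟩
  by_cases h0 : i = 0
  · exact key 1 (n - 1) (by omega) (by omega) (by omega) (by omega) (by omega) (by omega)
  · by_cases h1 : i + 1 = n
    · exact key (i - 1) 0 (by omega) (by omega) (by omega) (by omega) (by omega) (by omega)
    · exact key (i - 1) (i + 1) (by omega) (by omega) (by omega) (by omega) (by omega) (by omega)

/-- A hole stays connected when a clique is removed: two vertices split it into two arcs, and the
clique meets at most one of them. -/
lemma IsHoleSet.reachIn_diff {S Q : Set V} (hS : G.IsHoleSet S) (hQ : G.IsClique Q) {a b : V}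
    (ha : a ∈ S \ Q) (hb : b ∈ S \ Q) : G.ReachIn (S \ Q) a b := by
  obtain ⟨n, f, hn, hmem, hinj, hadj⟩ := hS
  obtain ⟨i, hi, rfl⟩ := (hmem a).1 ha.1
  obtain ⟨j, hj, rfl⟩ := (hmem b).1 hb.1
  wlog hij : i ≤ j generalizing i j
  · exact (this j hj hb i hi ha (by omega)).symm
  have hS : ∀ k, k < n → f k ∈ S := fun k hk => (hmem _).2 ⟨k, hk, rfl⟩
  have seg : ∀ d k, k + d < n → (∀ l, k ≤ l → l ≤ k + d → f l ∉ Q) →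
      G.ReachIn (S \ Q) (f k) (f (k + d)) := by
    intro d
    induction d with
    | zero => exact fun k _ _ => .refl
    | succ d ih =>
      intro k hk hl
      refine (ih k (by omega) fun l h h' => hl l h (by omega)).trans (.of_adj
        ⟨hS _ (by omega), hl _ (by omega) (by omega)⟩ ⟨hS _ (by omega), hl _ (by omega) (by omega)⟩
        ((hadj _ _ (by omega) (by omega)).2 (by omega)))
  by_cases hin : ∃ k, i ≤ k ∧ k ≤ j ∧ f k ∈ Q
  · obtain ⟨k, hik, hkj, hk⟩ := hin
    have hik' : k ≠ i := fun h => ha.2 (h ▸ hk)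
    have hkj' : k ≠ j := fun h => hb.2 (h ▸ hk)
    have hout : ∀ l, l < n → l ≤ i ∨ j ≤ l → f l ∉ Q := by
      intro l hl hl' hlQ
      have hli : l ≠ i := fun h => ha.2 (h ▸ hlQ)
      have hlj : l ≠ j := fun h => hb.2 (h ▸ hlQ)
      have hlk : f l ≠ f k := fun h => by
        have := hinj _ _ hl (by omega) h
        omega
      have := (hadj _ _ hl (by omega)).1 (hQ hlQ hk hlk)
      omega
    have h1 := seg i 0 (by omega) fun l _ h => hout l (by omega) (by omega)
    have h2 := seg (n - 1 - j) j (by omega) fun l h h' => hout l (by omega) (by omega)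
    rw [show j + (n - 1 - j) = n - 1 by omega] at h2
    rw [zero_add] at h1
    refine h1.symm.trans (.trans (.of_adj ⟨hS _ (by omega), hout _ (by omega) (by omega)⟩
      ⟨hS _ (by omega), hout _ (by omega) (by omega)⟩
      ((hadj _ _ (by omega) (by omega)).2 (by omega))) h2.symm)
  · push Not at hin
    have := seg (j - i) i (by omega) fun l h h' => hin l h (by omega)
    rwa [show i + (j - i) = j by omega] at this

/-- An induced path and a vertex adjacent to exactly its ends form a hole. -/
lemma IsIndPath.isHoleSet_insert {n : ℕ} {p : ℕ → V} (hp : G.IsIndPath n p) (hn : 2 ≤ n) {u : V}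
    (h0 : G.Adj u (p 0)) (h1 : G.Adj u (p n))
    (hu : ∀ i, 0 < i → i < n → p i ≠ u ∧ ¬ G.Adj u (p i)) :
    G.IsHoleSet (insert u {v | ∃ i, i ≤ n ∧ p i = v}) := by
  have hne : p 0 ≠ p n := fun h => by have := hp.inj 0 n (by omega) le_rfl h; omega
  have hnadj : ¬ G.Adj (p 0) (p n) := fun h => by
    have := (hp.adj 0 n (by omega) le_rfl).1 h
    omega
  have hnadj' : ¬ G.Adj (p n) (p 0) := fun h => hnadj h.symm
  let q : ℕ → V := fun i => if i = 0 then p 0 else if i = 1 then u else p n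
  have hq : G.IsIndPath 2 q := by
    constructor
    · intro i j hi hj
      interval_cases i <;> interval_cases j <;>
        simp [q, h0.ne, h0.ne', h1.ne, h1.ne', hne, hne.symm]
    · intro i j hi hj
      interval_cases i <;> interval_cases j <;>
        simp [q, h0, h1, h0.symm, h1.symm, hnadj, hnadj']
  have := isHoleSet_of_indPaths hp hq hn le_rfl (by simp [q]) (by simp [q]) (by
    intro i j hi hi' hj hj'
    obtain rfl : j = 1 := by omega
    have := hu i hi hi'
    exact ⟨by simpa [q] using this.1, by simpa [q, G.adj_comm] using this.2⟩)
  convert this using 1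
  ext v
  simp only [Set.mem_insert_iff, Set.mem_ofPred_eq, Set.mem_union]
  constructor
  · rintro (rfl | h)
    · exact .inr ⟨1, by omega, by omega, by simp [q]⟩
    · exact .inl h
  · rintro (h | ⟨i, hi, hi', rfl⟩)
    · exact .inr h
    · obtain rfl : i = 1 := by omega
      exact .inl (by simp [q])

/-- Two nonadjacent neighbors `x`, `y` of `u` that are linked through a connected set `E` without
neighbors of `u` lie with `u` on a hole. -/
lemma exists_isHoleSet {E : Set V} {u x y e f : V} (hux : G.Adj u x) (huy : G.Adj u y)
    (hxy : x ≠ y) (hnadj : ¬ G.Adj x y) (he : e ∈ E) (hxe : G.Adj x e) (hfy : G.Adj f y)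
    (hef : G.ReachIn E e f) (hE : ∀ v ∈ E, v ≠ u ∧ ¬ G.Adj u v) :
    ∃ S, G.IsHoleSet S ∧ u ∈ S ∧ x ∈ S ∧ y ∈ S ∧ ∀ v ∈ S, v = u ∨ v = x ∨ v = y ∨ v ∈ E := by
  obtain ⟨n, p, hn, hp, rfl, rfl, hpE⟩ := exists_indPath hxy hnadj he hxe hfy hef
  refine ⟨_, hp.isHoleSet_insert hn hux huy fun i hi hi' => hE _ (hpE i hi hi'), .inl rfl,
    .inr ⟨0, by omega, rfl⟩, .inr ⟨n, le_rfl, rfl⟩, ?_⟩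
  rintro v (rfl | ⟨i, hi, rfl⟩)
  · exact .inl rfl
  · by_cases h0 : i = 0
    · exact .inr (.inl (by rw [h0]))
    · by_cases h1 : i = n
      · exact .inr (.inr (.inl (by rw [h1])))
      · exact .inr (.inr (.inr (hpE i (by omega) (by omega))))

lemma not_isClique_iff_exists {S : Set V} :
    ¬ G.IsClique S ↔ ∃ x ∈ S, ∃ y ∈ S, x ≠ y ∧ ¬ G.Adj x y := by
  simp [IsClique, Set.Pairwise]

/-! ### Clique cutsets -/

/-- No clique separates two vertices of `W` in the subgraph of `G` induced by `W`. -/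
def NoCliqueCutset (G : SimpleGraph V) (W : Set V) : Prop :=
  ∀ Q, G.IsClique Q → ∀ a ∈ W \ Q, ∀ b ∈ W \ Q, G.ReachIn (W \ Q) a b

/-- If all neighbors of `M` outside of `M` lie in a clique, then nothing else is left. -/
lemma NoCliqueCutset.subset_union {W M Q : Set V} (hW : G.NoCliqueCutset W) (hQ : G.IsClique Q)
    {m : V} (hmW : m ∈ W) (hmM : m ∈ M) (hmQ : m ∉ Q)
    (hM : ∀ x ∈ M, ∀ y ∈ W, G.Adj x y → y ∈ M ∨ y ∈ Q) : W ⊆ M ∪ Q := by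
  intro w hw
  by_contra h
  have hwQ : w ∉ Q := fun h' => h (.inr h')
  refine h (.inl ((hW Q hQ m ⟨hmW, hmQ⟩ w ⟨hw, hwQ⟩).mem_of_closed hmM ?_))
  intro x hx y hy hxy
  exact (hM x hx y hy.1 hxy).resolve_right hy.2

/-- Induction over clique cutsets: if `P` holds for some vertex outside of any given clique in each
set without clique cutset, then it does so in every set, provided that it does not depend on the
vertices beyond the neighborhood. The clique cutset is the clique to be avoided in the smaller
set. -/
lemma exists_of_noCliqueCutset [Finite V] (P : Set V → V → Prop)
    (hP : ∀ W W' v, W' ⊆ W → (∀ w ∈ W, G.Adj v w → w ∈ W') → P W' v → P W v) (W₀ : Set V)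
    (atom : ∀ W ⊆ W₀, G.NoCliqueCutset W → ∀ Q, G.IsClique Q → (W \ Q).Nonempty →
      ∃ v ∈ W \ Q, P W v) :
    ∀ W ⊆ W₀, ∀ Q, G.IsClique Q → (W \ Q).Nonempty → ∃ v ∈ W \ Q, P W v := by
  intro W
  induction h : W.ncard using Nat.strong_induction_on generalizing W with
  | _ n ih =>
  intro hW₀ Q hQ hne
  by_cases hW : G.NoCliqueCutset W
  · exact atom W hW₀ hW Q hQ hne
  unfold NoCliqueCutset at hW
  push Not at hW
  obtain ⟨S, hS, a, ha, b, hb, hab⟩ := hW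
  have main : ∀ a ∈ W \ S, ∀ b ∈ W \ S, ¬ G.ReachIn (W \ S) a b →
      (∀ q ∈ Q, q ∉ G.compIn (W \ S) b) → ∃ v ∈ W \ Q, P W v := by
    intro a ha b hb hab hQb
    have hsub : W ∩ (G.compIn (W \ S) b ∪ S) ⊆ W := Set.inter_subset_left
    have hcard : (W ∩ (G.compIn (W \ S) b ∪ S)).ncard < n := by
      rw [← h]
      refine Set.ncard_lt_ncard (Set.ssubset_iff_subset_ne.2 ⟨hsub, fun e => ?_⟩) (Set.toFinite _)
      have := e.symm ▸ ha.1
      exact this.2.elim (fun h => hab (ReachIn.symm h)) ha.2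
    obtain ⟨v, hv, hPv⟩ := ih _ hcard _ rfl (hsub.trans hW₀) S hS
      ⟨b, ⟨hb.1, .inl (mem_compIn_self _ _)⟩, hb.2⟩
    have hvb : v ∈ G.compIn (W \ S) b := hv.1.2.resolve_right hv.2
    refine ⟨v, ⟨hv.1.1, fun h => hQb v h hvb⟩, hP _ _ v hsub (fun w hw hvw => ⟨hw, ?_⟩) hPv⟩
    by_cases hwS : w ∈ S
    · exact .inr hwS
    · exact .inl (mem_compIn_of_adj hb hvb ⟨hw, hwS⟩ hvw)
  by_cases hQb : ∀ q ∈ Q, q ∉ G.compIn (W \ S) b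
  · exact main a ha b hb hab hQb
  · push Not at hQb
    obtain ⟨q, hq, hqb⟩ := hQb
    refine main b hb a ha (fun h => hab h.symm) fun r hr hra => hab ?_
    by_cases e : q = r
    · exact ReachIn.trans hra (e ▸ ReachIn.symm hqb)
    · exact ReachIn.trans (mem_compIn_of_adj ha hra (compIn_subset hb hqb) (hQ hr hq (Ne.symm e)))
        (ReachIn.symm hqb)

/-! ### Chordal sets of vertices -/

/-- In a chordal graph two nonadjacent vertices are separated by a clique. -/
lemma exists_isClique_separating {X : Set V} (hX : ∀ S ⊆ X, ¬ G.IsHoleSet S) {s t : V}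
    (hs : s ∈ X) (ht : t ∈ X) (hst : s ≠ t) (hnadj : ¬ G.Adj s t) :
    ∃ Q, G.IsClique Q ∧ Q ⊆ X ∧ s ∉ Q ∧ t ∉ Q ∧ ¬ G.ReachIn (X \ Q) s t := by
  -- the clique consists of the neighbors of `s` next to the component of `t` beyond them
  set R : Set V := {v | v ∈ X ∧ v ≠ s ∧ ¬ G.Adj s v} with hR
  have htR : t ∈ R := ⟨ht, hst.symm, hnadj⟩
  set B := G.compIn R t with hB
  have hBR : B ⊆ R := compIn_subset htR
  refine ⟨{v | v ∈ X ∧ G.Adj s v ∧ ∃ b ∈ B, G.Adj v b}, ?_, fun v hv => hv.1,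
    fun h => h.2.1.ne rfl, fun h => hnadj h.2.1, fun hreach => ?_⟩
  · by_contra hcl
    obtain ⟨x, ⟨hx, hsx, e, he, hxe⟩, y, ⟨hy, hsy, f, hf, hyf⟩, hxy, hna⟩ :=
      not_isClique_iff_exists.1 hcl
    obtain ⟨S, hS, -, -, -, hsub⟩ := exists_isHoleSet hsx hsy hxy hna he hxe hyf.symm
      (reachIn_compIn he hf) fun v hv => (hBR hv).2
    refine hX S (fun v hv => ?_) hS
    rcases hsub v hv with rfl | rfl | rfl | h
    exacts [hs, hx, hy, (hBR h).1]
  · refine (hBR (hreach.symm.mem_of_closed (Y := B) (mem_compIn_self _ _) ?_)).2.1 rfl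
    intro x hx y hy hxy
    have hys : y ≠ s := fun e => (hBR hx).2.2 (e ▸ hxy.symm)
    refine mem_compIn_of_adj htR hx ⟨hy.1, hys, fun hsy => hy.2 ⟨hy.1, hsy, x, hx, hxy.symm⟩⟩ hxy

/-- Dirac's theorem: a chordal graph has a simplicial vertex outside of any clique that does not
contain all vertices. -/
lemma exists_simplicial [Finite V] {X : Set V} (hX : ∀ S ⊆ X, ¬ G.IsHoleSet S) {Q : Set V}
    (hQ : G.IsClique Q) (hne : (X \ Q).Nonempty) :
    ∃ v ∈ X \ Q, G.IsClique {w | w ∈ X ∧ G.Adj v w} := by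
  refine exists_of_noCliqueCutset (fun W v => G.IsClique {w | w ∈ W ∧ G.Adj v w}) ?_ X ?_ X
    subset_rfl Q hQ hne
  · intro W W' v _ hW' h
    exact fun a ha b hb => h ⟨hW' a ha.1 ha.2, ha.2⟩ ⟨hW' b hb.1 hb.2, hb.2⟩
  · rintro W hWX hW Q - ⟨v, hv⟩
    refine ⟨v, hv, ?_⟩
    by_contra hcl
    obtain ⟨x, ⟨hx, -⟩, y, ⟨hy, -⟩, hxy, hna⟩ := not_isClique_iff_exists.1 hcl
    obtain ⟨T, hT, -, hxT, hyT, h⟩ := exists_isClique_separating (fun S hS => hX S (hS.trans hWX))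
      hx hy hxy hna
    exact h (hW T hT x ⟨hx, hxT⟩ y ⟨hy, hyT⟩)

/-! ### The non-consecutive property -/

/-- `C` is a hole cover of `G` satisfying the NC property, in terms of vertex sets of holes: each
hole has exactly one vertex in `C`, and of two holes that share consecutive edges both or none
contain a given vertex of `C`. -/
structure IsNCCover (G : SimpleGraph V) (C : Set V) : Prop where
  exists_mem : ∀ S, G.IsHoleSet S → ∃ u ∈ C, u ∈ S
  unique : ∀ S, G.IsHoleSet S → ∀ u ∈ C, ∀ v ∈ C, u ∈ S → v ∈ S → u = v
  mem_of_share : ∀ u ∈ C, ∀ S T, G.IsHoleSet S → G.IsHoleSet T → u ∈ S → ∀ x y z, x ≠ z →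
    G.Adj x y → G.Adj y z → x ∈ S → y ∈ S → z ∈ S → x ∈ T → y ∈ T → z ∈ T → u ∈ T

lemma cycleGraph_adj_iff_val {n : ℕ} (hn : 2 ≤ n) (i j : Fin n) :
    (cycleGraph n).Adj i j ↔ i.val + 1 = j.val ∨ j.val + 1 = i.val ∨
      (i.val = 0 ∧ j.val + 1 = n) ∨ (j.val = 0 ∧ i.val + 1 = n) := by
  have key : ∀ i j : Fin n, (i - j).val = 1 ↔ j.val + 1 = i.val ∨ (i.val = 0 ∧ j.val + 1 = n) := by
    intro i j
    have hi := i.isLt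
    have hj := j.isLt
    rw [Fin.sub_def]
    simp only
    rcases Nat.lt_or_ge i.val j.val with h | h
    · rw [Nat.mod_eq_of_lt (by omega)]
      omega
    · rw [show n - j.val + i.val = (i.val - j.val) + n by omega, Nat.add_mod_right,
        Nat.mod_eq_of_lt (by omega)]
      omega
  rw [cycleGraph_adj', key, key]
  omega

lemma IsHole.isHoleSet {H : G.Subgraph} (h : G.IsHole H) : G.IsHoleSet H.verts := by
  obtain ⟨hind, n, hn, ⟨e⟩⟩ := h
  have hadj : ∀ i j : Fin n, G.Adj (e.symm i) (e.symm j) ↔ (cycleGraph n).Adj i j := by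
    intro i j
    rw [← e.symm.map_adj_iff, Subgraph.coe_adj]
    exact ⟨hind (e.symm i).2 (e.symm j).2, fun h => h.adj_sub⟩
  refine ⟨n, fun i => if hi : i < n then e.symm ⟨i, hi⟩ else e.symm ⟨0, by omega⟩, hn, ?_, ?_, ?_⟩
  · intro v
    constructor
    · intro hv
      exact ⟨e ⟨v, hv⟩, (e ⟨v, hv⟩).isLt, by simp⟩
    · rintro ⟨i, hi, rfl⟩
      simp [hi]
  · intro i j hi hj h
    simp only [hi, hj, dif_pos] at h
    simpa using e.symm.injective (Subtype.ext h)
  · intro i j hi hj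
    simp only [hi, hj, dif_pos]
    rw [hadj, cycleGraph_adj_iff_val (by omega)]

lemma IsHoleSet.isHole {S : Set V} (h : G.IsHoleSet S) :
    G.IsHole ((⊤ : G.Subgraph).induce S) := by
  obtain ⟨n, f, hn, hmem, hinj, hadj⟩ := h
  refine ⟨fun v hv w hw h => ⟨hv, hw, h⟩, n, hn, ⟨Iso.symm ?_⟩⟩
  have hfS : ∀ i : Fin n, f i ∈ S := fun i => (hmem _).2 ⟨i, i.isLt, rfl⟩
  refine ⟨Equiv.ofBijective (fun i : Fin n => (⟨f i, hfS i⟩ : S)) ⟨?_, ?_⟩, ?_⟩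
  · intro i j h
    exact Fin.ext (hinj i j i.isLt j.isLt (congrArg Subtype.val h))
  · rintro ⟨v, hv⟩
    obtain ⟨i, hi, rfl⟩ := (hmem v).1 hv
    exact ⟨⟨i, hi⟩, rfl⟩
  · intro i j
    rw [cycleGraph_adj_iff_val (by omega), ← hadj i j i.isLt j.isLt]
    exact ⟨fun h => h.2.2, fun h => ⟨hfS i, hfS j, h⟩⟩

lemma HasNCProperty.exists_isNCCover (h : G.HasNCProperty) : ∃ C, G.IsNCCover C := by
  obtain ⟨C, ⟨-, hcov⟩, hNC, huniq⟩ := h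
  refine ⟨C, fun S hS => hcov _ hS.isHole, fun S hS u hu v hv huS hvS =>
    huniq _ hS.isHole ⟨huS, hu⟩ ⟨hvS, hv⟩, ?_⟩
  intro u hu S T hS hT huS x y z hxz hxy hyz hx hy hz hx' hy' hz'
  by_contra huT
  exact hNC u hu _ _ hS.isHole hT.isHole huS huT
    ⟨x, y, z, hxz, ⟨⟨hx, hy, hxy⟩, ⟨hy, hz, hyz⟩⟩, ⟨hx', hy', hxy⟩, ⟨hy', hz', hyz⟩⟩

/-- Two holes with a common subpath of length at least two contain the same vertices of `C`. -/
lemma IsNCCover.mem_of_indPath {C : Set V} (hC : G.IsNCCover C) {u : V} (hu : u ∈ C) {S T : Set V}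
    (hS : G.IsHoleSet S) (hT : G.IsHoleSet T) (huS : u ∈ S) {n : ℕ} {p : ℕ → V}
    (hp : G.IsIndPath n p) (hn : 2 ≤ n) (hpS : ∀ i, i ≤ n → p i ∈ S)
    (hpT : ∀ i, i ≤ n → p i ∈ T) : u ∈ T :=
  hC.mem_of_share u hu S T hS hT huS (p 0) (p 1) (p 2)
    (fun h => by have := hp.inj 0 2 (by omega) hn h; omega)
    ((hp.adj 0 1 (by omega) (by omega)).2 (by omega))
    ((hp.adj 1 2 (by omega) (by omega)).2 (by omega))
    (hpS _ (by omega)) (hpS _ (by omega)) (hpS _ (by omega))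
    (hpT _ (by omega)) (hpT _ (by omega)) (hpT _ (by omega))

/-! ### Sets without clique cutset -/

/-- Without clique cutset, all neighbors of `u ∈ C` attach to each component of the non-neighbors
of `u`: otherwise some set `M` misses the component `E`, and two nonadjacent vertices linked through
`M`, `E` and `u` would lie on two holes sharing the path through `E`, only one of them through
`u`. -/
lemma IsNCCover.exists_adj_comp {C W : Set V} (hC : G.IsNCCover C) (hW : G.NoCliqueCutset W)
    {u e₀ : V} (huC : u ∈ C) (he₀ : e₀ ∈ {w | w ∈ W ∧ w ≠ u ∧ ¬ G.Adj u w})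
    {m : V} (hm : m ∈ W) (hum : G.Adj u m) :
    ∃ e ∈ G.compIn {w | w ∈ W ∧ w ≠ u ∧ ¬ G.Adj u w} e₀, G.Adj m e := by
  set R : Set V := {w | w ∈ W ∧ w ≠ u ∧ ¬ G.Adj u w} with hR
  set E := G.compIn R e₀ with hE
  have hER : E ⊆ R := compIn_subset he₀
  by_contra hno
  push Not at hno
  -- `B` is what remains of `W` without `u`, the component `E`, and the neighbors of `u` next to `E`
  let B : Set V := {w | w ∈ W ∧ w ≠ u ∧ w ∉ E ∧ ¬ (G.Adj u w ∧ ∃ e ∈ E, G.Adj w e)}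
  have hmB : m ∈ B := ⟨hm, hum.ne', fun h => (hER h).2.2 hum, fun ⟨_, e, he, h⟩ => hno e he h⟩
  let M := G.compIn B m
  have hMB : M ⊆ B := compIn_subset hmB
  have hBE : ∀ b ∈ B, ∀ e ∈ E, ¬ G.Adj b e := by
    intro b hb e he h
    by_cases hub : G.Adj u b
    · exact hb.2.2.2 ⟨hub, e, he, h⟩
    · exact hb.2.2.1 (mem_compIn_of_adj he₀ he ⟨hb.1, hb.2.1, hub⟩ h.symm)
  -- the neighbors of `M` outside of `M` form a clique
  let T : Set V := {x | (x = u ∨ G.Adj u x ∧ ∃ e ∈ E, G.Adj x e) ∧ ∃ m' ∈ M, G.Adj x m'}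
  have hT : G.IsClique T := by
    rintro x ⟨hx, m₁, hm₁, hxm⟩ y ⟨hy, m₂, hm₂, hym⟩ hxy
    rcases hx with rfl | ⟨hux, e, he, hxe⟩
    · rcases hy with rfl | ⟨huy, -⟩
      exacts [absurd rfl hxy, huy]
    rcases hy with rfl | ⟨huy, f, hf, hyf⟩
    · exact hux.symm
    by_contra hna
    obtain ⟨n, p, hn, hp, hp0, hpn, hpE⟩ :=
      exists_indPath hxy hna he hxe hyf.symm (reachIn_compIn he hf)
    obtain ⟨k, q, hk, hq, hq0, hqk, hqM⟩ :=
      exists_indPath hxy hna hm₁ hxm hym.symm (reachIn_compIn hm₁ hm₂)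
    have h1 := hp.isHoleSet_insert hn (u := u) (hp0 ▸ hux) (hpn ▸ huy)
      fun i hi hi' => (hER (hpE i hi hi')).2
    have h2 := isHoleSet_of_indPaths hp hq hn hk (hp0.trans hq0.symm) (hpn.trans hqk.symm) (by
      intro i j hi hi' hj hj'
      have h := hMB (hqM j hj hj')
      exact ⟨fun e => h.2.2.1 (e ▸ hpE i hi hi'), fun e => hBE _ h _ (hpE i hi hi') e.symm⟩)
    have := hC.mem_of_indPath huC h1 h2 (.inl rfl) hp hn (fun i hi => .inr ⟨i, hi, rfl⟩)
      fun i hi => .inl ⟨i, hi, rfl⟩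
    rcases this with ⟨i, hi, h⟩ | ⟨i, hi, hi', h⟩
    · by_cases hi0 : i = 0
      · exact hux.ne (by rw [← h, hi0, hp0])
      · by_cases hin : i = n
        · exact huy.ne (by rw [← h, hin, hpn])
        · exact (hER (hpE i (by omega) (by omega))).2.1 h
    · exact (hMB (hqM i hi hi')).2.1 h
  have hsub := hW.subset_union (M := M) hT hm (mem_compIn_self _ _)
    (fun h => h.1.elim hum.ne' fun ⟨_, e, he, h⟩ => hno e he h) (by
      intro x hx y hy hxy
      by_cases hyT : y ∈ T
      · exact .inr hyT
      · refine .inl (mem_compIn_of_adj hmB hx ⟨hy, fun h => hyT ⟨.inl h, x, hx, hxy.symm⟩,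
          fun h => hBE x (hMB hx) y h hxy, fun h => hyT ⟨.inr h, x, hx, hxy.symm⟩⟩ hxy))
  rcases hsub he₀.1 with h | h
  · exact (hMB h).2.2.1 (mem_compIn_self _ _)
  · exact h.1.elim he₀.2.1 fun h => he₀.2.2 h.1

/-- A neighbor `d` of `u ∈ C` on no common hole with `u`, which is adjacent to the neighbors of `u`
on the hole `S`, is adjacent to all of `S`: a vertex of `S` not adjacent to `d` would lie in the
interior of an arc of `S` that forms with `d` a hole. By the NC property, the vertex `u` of `S`
would lie on it, together with `d`. -/
lemma IsNCCover.adj_of_mem_hole {C W : Set V} (hC : G.IsNCCover C) {u d : V} (huC : u ∈ C)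
    (hdW : d ∈ W) (hud : G.Adj u d) (hd : ∀ S ⊆ W, G.IsHoleSet S → u ∈ S → d ∉ S)
    (hdu : ∀ x ∈ W, x ≠ d → G.Adj u x → G.Adj d x)
    {S : Set V} (hSW : S ⊆ W) (hS : G.IsHoleSet S) (huS : u ∈ S) {p : V} (hp : p ∈ S) :
    G.Adj d p := by
  by_contra hdp
  have hdS : d ∉ S := hd S hSW hS huS
  have hpX : p ∈ {v | v ∈ S ∧ ¬ G.Adj d v} := ⟨hp, hdp⟩
  set X := G.compIn {v | v ∈ S ∧ ¬ G.Adj d v} p with hX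
  have hXS : X ⊆ {v | v ∈ S ∧ ¬ G.Adj d v} := compIn_subset hpX
  -- if the boundary of `X` were a clique, it would not separate the hole, so it would contain all
  -- neighbors of `d` on the hole, among them two nonadjacent neighbors of `u`
  by_cases hQ : G.IsClique {q | q ∈ S ∧ G.Adj d q ∧ ∃ x ∈ X, G.Adj q x}
  · obtain ⟨x, hx, y, hy, hxy, hna, hux, huy⟩ := hS.exists_neighbors huS
    have key : ∀ z ∈ S, G.Adj d z → ∃ x ∈ X, G.Adj z x := by
      intro z hz hdz
      by_contra hno
      have := hS.reachIn_diff hQ (a := p) (b := z) ⟨hp, fun h => hdp h.2.1⟩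
        ⟨hz, fun h => hno h.2.2⟩
      refine (hXS (this.mem_of_closed (Y := X) (mem_compIn_self _ _) ?_)).2 hdz
      intro a ha b hb hab
      exact mem_compIn_of_adj hpX ha ⟨hb.1, fun h => hb.2 ⟨hb.1, h, a, ha, hab.symm⟩⟩ hab
    have hdx := hdu x (hSW hx) (fun h => hdS (h ▸ hx)) hux
    have hdy := hdu y (hSW hy) (fun h => hdS (h ▸ hy)) huy
    exact hna (hQ ⟨hx, hdx, key x hx hdx⟩ ⟨hy, hdy, key y hy hdy⟩ hxy)
  · obtain ⟨s, ⟨hs, hds, e, he, hse⟩, t, ⟨ht, hdt, f, hf, htf⟩, hst, hna⟩ :=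
      not_isClique_iff_exists.1 hQ
    obtain ⟨n, q, hn, hq, rfl, rfl, hqX⟩ :=
      exists_indPath hst hna he hse htf.symm (reachIn_compIn he hf)
    have hqS : ∀ i, i ≤ n → q i ∈ S := by
      intro i hi
      by_cases hi0 : i = 0
      · rwa [hi0]
      · by_cases hin : i = n
        · rwa [hin]
        · exact (hXS (hqX i (by omega) (by omega))).1
    have h2 := hq.isHoleSet_insert hn hds hdt fun i hi hi' =>
      ⟨fun h => hdS (h ▸ hqS i hi'.le), (hXS (hqX i hi hi')).2⟩
    refine hd _ ?_ h2 (hC.mem_of_indPath huC hS h2 huS hq hn hqS fun i hi => .inr ⟨i, hi, rfl⟩)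
      (.inl rfl)
    rintro v (rfl | ⟨i, hi, rfl⟩)
    exacts [hdW, hSW (hqS i hi)]

/-- If two vertices `s`, `t` of a chordal set `X` are nonadjacent and each lies on a hole with `u`
whose other vertices are in `X`, then a connected set `D` with neighbors `s` and `t` and no neighbor
`u` meets a hole through `u`. -/
lemma exists_isHoleSet_through {X D : Set V} {u s t d e : V}
    (hX : ∀ S ⊆ X, ¬ G.IsHoleSet S) (huX : u ∉ X) (hs : s ∈ X) (ht : t ∈ X) (hst : s ≠ t)
    (hna : ¬ G.Adj s t)
    (hsu : ∃ S, G.IsHoleSet S ∧ u ∈ S ∧ s ∈ S ∧ S ⊆ insert u X)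
    (htu : ∃ S, G.IsHoleSet S ∧ u ∈ S ∧ t ∈ S ∧ S ⊆ insert u X)
    (hDX : ∀ v ∈ D, v ∉ X ∧ v ≠ u ∧ ¬ G.Adj u v) (hd : d ∈ D) (he : e ∈ D)
    (hDconn : ∀ a ∈ D, ∀ b ∈ D, G.ReachIn D a b) (hds : G.Adj d s) (het : G.Adj e t) :
    ∃ S, G.IsHoleSet S ∧ u ∈ S ∧ S ⊆ X ∪ D ∪ {u} ∧ ∃ v ∈ D, v ∈ S := by
  obtain ⟨Q, hQ, hQX, hsQ, htQ, hsep⟩ := exists_isClique_separating hX hs ht hst hna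
  set N : Set V := {v | ∃ d ∈ D, G.Adj d v} with hN
  have huN : u ∉ N := fun ⟨d, hd, h⟩ => (hDX d hd).2.2 h.symm
  -- from `s` as from `t` one gets to `u` along the hole, without meeting `Q`; consider the vertex
  -- next to `D` on this way that is closest to `u`
  have half : ∀ s ∈ X, s ∉ Q → s ∈ N →
      (∃ S, G.IsHoleSet S ∧ u ∈ S ∧ s ∈ S ∧ S ⊆ insert u X) →
      ∃ s' ∈ G.compIn (X \ Q) s, s' ∈ N ∧ ∃ a ∈ insert u (G.compIn (X \ Q) s \ N),
        G.ReachIn (insert u (G.compIn (X \ Q) s \ N)) u a ∧ G.Adj a s' := by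
    rintro s hs hsQ hsN ⟨S, hS, huS, hsS, hSX⟩
    have hsu : s ≠ u := fun h => huX (h ▸ hs)
    obtain ⟨c, u', hsc, hcu, -, hu', hadj⟩ := (hS.reachIn_diff hQ ⟨hsS, hsQ⟩
      ⟨huS, fun h => huX (hQX h)⟩).exists_first (P := {u}) hsu rfl
    rw [show u' = u from hu'] at hadj
    have hsub : (S \ Q) \ {u} ⊆ X \ Q := fun v hv => ⟨(hSX hv.1.1).resolve_left hv.2, hv.1.2⟩
    have hc : c ∈ G.compIn (X \ Q) s := hsc.mono hsub
    by_cases hcN : c ∈ N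
    · exact ⟨c, hc, hcN, u, .inl rfl, .refl, hadj.symm⟩
    · obtain ⟨a, s', hca, haN, hs', hs'N, has'⟩ :=
        (reachIn_compIn hc (mem_compIn_self _ _)).exists_first hcN hsN
      have ha : a ∈ G.compIn (X \ Q) s \ N :=
        hca.mem_of_closed (Y := G.compIn (X \ Q) s \ N) ⟨hc, hcN⟩ fun _ _ y hy _ => hy
      refine ⟨s', hs', hs'N, a, .inr ha, ?_, has'⟩
      exact (ReachIn.of_adj (X := insert u (G.compIn (X \ Q) s \ N)) (.inl rfl)
        (.inr ⟨hc, hcN⟩) hadj.symm).trans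
        (hca.mono (Set.subset_insert _ _))
  obtain ⟨s', hs', ⟨d₁, hd₁, hds'⟩, a, ha, hua, has'⟩ := half s hs hsQ ⟨d, hd, hds⟩ hsu
  obtain ⟨t', ht', ⟨d₂, hd₂, hdt'⟩, b, hb, hub, hbt'⟩ := half t ht htQ ⟨e, he, het⟩ htu
  set Cs := G.compIn (X \ Q) s with hCs
  set Ct := G.compIn (X \ Q) t with hCt
  have hCsX : Cs ⊆ X \ Q := compIn_subset ⟨hs, hsQ⟩
  have hCtX : Ct ⊆ X \ Q := compIn_subset ⟨ht, htQ⟩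
  have hdisj : ∀ v ∈ Cs, v ∉ Ct := fun v hv hv' => hsep (ReachIn.trans hv (ReachIn.symm hv'))
  have hst' : s' ≠ t' := fun h => hdisj s' hs' (h ▸ ht')
  have hna' : ¬ G.Adj s' t' := fun h =>
    hdisj t' (mem_compIn_of_adj ⟨hs, hsQ⟩ hs' (hCtX ht') h) ht'
  set A : Set V := insert u (Cs \ N ∪ Ct \ N) with hA
  have hsA : insert u (Cs \ N) ⊆ A := Set.insert_subset_insert Set.subset_union_left
  have htA : insert u (Ct \ N) ⊆ A := Set.insert_subset_insert Set.subset_union_right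
  obtain ⟨n, p, hn, hp, hp0, hpn, hpA⟩ := exists_indPath hst' hna' (hsA ha) has'.symm hbt'
    ((hua.mono hsA).symm.trans (hub.mono htA))
  obtain ⟨k, q, hk, hq, hq0, hqk, hqD⟩ := exists_indPath hst' hna' hd₁ hds'.symm hdt'
    (hDconn d₁ hd₁ d₂ hd₂)
  have hAD : ∀ v ∈ A, v ∉ N ∧ v ∉ D := by
    rintro v (rfl | hv | hv)
    · exact ⟨huN, fun h => (hDX v h).2.1 rfl⟩
    · exact ⟨hv.2, fun h => (hDX v h).1 (hCsX hv.1).1⟩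
    · exact ⟨hv.2, fun h => (hDX v h).1 (hCtX hv.1).1⟩
  have hhole := isHoleSet_of_indPaths hp hq hn hk (hp0.trans hq0.symm) (hpn.trans hqk.symm) (by
    intro i j hi hi' hj hj'
    exact ⟨fun h => (hAD _ (hpA i hi hi')).2 (h ▸ hqD j hj hj'),
      fun h => (hAD _ (hpA i hi hi')).1 ⟨_, hqD j hj hj', h.symm⟩⟩)
  refine ⟨_, hhole, .inl ?_, ?_, q 1, hqD 1 (by omega) (by omega),
    .inr ⟨1, by omega, by omega, rfl⟩⟩
  · -- the two components are only joined through `u`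
    by_contra hu
    have hpu : ∀ i, i ≤ n → p i ≠ u := fun i hi h => hu ⟨i, hi, h⟩
    have hpX : ∀ i, i ≤ n → p i ∈ X \ Q := by
      intro i hi
      by_cases hi0 : i = 0
      · exact hi0 ▸ hp0 ▸ hCsX hs'
      by_cases hin : i = n
      · exact hin ▸ hpn ▸ hCtX ht'
      rcases hpA i (by omega) (by omega) with h | h | h
      exacts [absurd h (hpu i hi), hCsX h.1, hCtX h.1]
    have : ∀ i, i ≤ n → p i ∈ Cs := by
      intro i
      induction i with
      | zero => exact fun _ => hp0 ▸ hs'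
      | succ i ih =>
        exact fun hi => mem_compIn_of_adj ⟨hs, hsQ⟩ (ih (by omega)) (hpX _ hi)
          ((hp.adj _ _ (by omega) hi).2 (by omega))
    exact hdisj _ (hpn ▸ this n le_rfl) ht'
  · rintro v (⟨i, hi, rfl⟩ | ⟨i, hi, hi', rfl⟩)
    · by_cases hi0 : i = 0
      · exact .inl (.inl (hi0 ▸ hp0 ▸ (hCsX hs').1))
      by_cases hin : i = n
      · exact .inl (.inl (hin ▸ hpn ▸ (hCtX ht').1))
      rcases hpA i (by omega) (by omega) with h | h | h
      exacts [.inr h, .inl (.inl (hCsX h.1).1), .inl (.inl (hCtX h.1).1)]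
    · exact .inl (.inr (hqD i hi hi'))

/-- In a graph without clique cutset that has the NC property, all holes have a common vertex. -/
lemma IsNCCover.exists_forall_mem {C W : Set V} (hC : G.IsNCCover C) (hW : G.NoCliqueCutset W)
    {S₀ : Set V} (hS₀W : S₀ ⊆ W) (hS₀ : G.IsHoleSet S₀) :
    ∃ u ∈ W, ∀ S ⊆ W, G.IsHoleSet S → u ∈ S := by
  obtain ⟨u, huC, huS₀⟩ := hC.exists_mem S₀ hS₀
  have huW := hS₀W huS₀
  refine ⟨u, huW, ?_⟩
  obtain ⟨e₀, he₀S, he₀u, hue₀⟩ := hS₀.exists_not_adj huS₀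
  have he₀ : e₀ ∈ {w | w ∈ W ∧ w ≠ u ∧ ¬ G.Adj u w} := ⟨hS₀W he₀S, he₀u, hue₀⟩
  -- `U` is the union of the holes through `u`, and `Z` consists of the other neighbors of `u`
  set U : Set V := {v | ∃ S ⊆ W, G.IsHoleSet S ∧ u ∈ S ∧ v ∈ S} with hU
  set Z : Set V := {v | v ∈ W ∧ G.Adj u v ∧ v ∉ U} with hZ
  have hUW : U ⊆ W := fun v ⟨S, hSW, _, _, hv⟩ => hSW hv
  have hZnbr : ∀ z ∈ Z, ∀ x ∈ W, x ≠ z → G.Adj u x → G.Adj z x := by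
    intro z hz x hx hxz hux
    by_contra hna
    obtain ⟨e, he, hze⟩ := hC.exists_adj_comp hW huC he₀ hz.1 hz.2.1
    obtain ⟨f, hf, hxf⟩ := hC.exists_adj_comp hW huC he₀ hx hux
    obtain ⟨S, hS, huS, hzS, -, hsub⟩ := exists_isHoleSet hz.2.1 hux hxz.symm hna he hze hxf.symm
      (reachIn_compIn he hf) fun v hv => (compIn_subset he₀ hv).2
    refine hz.2.2 ⟨S, fun v hv => ?_, hS, huS, hzS⟩
    rcases hsub v hv with rfl | rfl | rfl | h
    exacts [huW, hz.1, hx, (compIn_subset he₀ h).1]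
  have hZU : ∀ z ∈ Z, ∀ x ∈ U, G.Adj z x := by
    rintro z hz x ⟨S, hSW, hS, huS, hxS⟩
    exact hC.adj_of_mem_hole huC hz.1 hz.2.1 (fun T hTW hT huT hzT => hz.2.2 ⟨T, hTW, hT, huT, hzT⟩)
      (hZnbr z hz) hSW hS huS hxS
  have hholeU : ∀ S ⊆ U, G.IsHoleSet S → u ∈ S := by
    intro S hSU hS
    obtain ⟨v, hvC, hvS⟩ := hC.exists_mem S hS
    obtain ⟨T, -, hT, huT, hvT⟩ := hSU hvS
    rwa [hC.unique T hT u huC v hvC huT hvT]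
  -- the neighbors of any remaining component `D` would form a clique cutset
  have hWUZ : W ⊆ U ∪ Z := by
    by_contra hcon
    obtain ⟨d₀, hd₀W, hd₀⟩ := Set.not_subset.1 hcon
    have hd₀B : d₀ ∈ W \ (U ∪ Z) := ⟨hd₀W, hd₀⟩
    set D := G.compIn (W \ (U ∪ Z)) d₀ with hD
    have hDB : D ⊆ W \ (U ∪ Z) := compIn_subset hd₀B
    have huU : u ∈ U := ⟨S₀, hS₀W, hS₀, huS₀, huS₀⟩
    have hDu : ∀ v ∈ D, v ≠ u ∧ ¬ G.Adj u v := fun v hv =>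
      ⟨fun h => (hDB hv).2 (.inl (h ▸ huU)), fun h =>
        (hDB hv).2 (.inr ⟨(hDB hv).1, h, fun h' => (hDB hv).2 (.inl h')⟩)⟩
    have hTU : ∀ s ∈ U, (∃ d ∈ D, G.Adj d s) → ∀ t ∈ U, (∃ d ∈ D, G.Adj d t) → s ≠ t →
        G.Adj s t := by
      rintro s hs ⟨d, hd, hds⟩ t ht ⟨e, he, het⟩ hst
      by_contra hna
      have hsu : s ≠ u := fun h => (hDu d hd).2 (h ▸ hds.symm)
      have htu : t ≠ u := fun h => (hDu e he).2 (h ▸ het.symm)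
      have hin : ∀ s ∈ U, ∃ S, G.IsHoleSet S ∧ u ∈ S ∧ s ∈ S ∧ S ⊆ insert u (U \ {u}) := by
        rintro s ⟨S, hSW, hS, huS, hsS⟩
        refine ⟨S, hS, huS, hsS, fun v hv => ?_⟩
        rw [Set.insert_sdiff_singleton]
        exact .inr ⟨S, hSW, hS, huS, hv⟩
      obtain ⟨S, hS, huS, hSsub, v, hvD, hvS⟩ := exists_isHoleSet_through (X := U \ {u}) (D := D)
        (u := u) (fun S hSX hS => (hSX (hholeU S (fun v hv => (hSX hv).1) hS)).2 rfl)
        (fun h => h.2 rfl) ⟨hs, hsu⟩ ⟨ht, htu⟩ hst hna (hin s hs) (hin t ht)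
        (fun v hv => ⟨fun h => (hDB hv).2 (.inl h.1), hDu v hv⟩) hd he
        (fun a ha b hb => reachIn_compIn ha hb) hds het
      refine (hDB hvD).2 (.inl ⟨S, fun w hw => ?_, hS, huS, hvS⟩)
      rcases hSsub hw with (h | h) | h
      exacts [hUW h.1, (hDB h).1, h ▸ huW]
    set T : Set V := {s | s ∈ U ∪ Z ∧ ∃ d ∈ D, G.Adj d s} with hT
    have hTcl : G.IsClique T := by
      rintro s ⟨hs | hs, hsD⟩ t ⟨ht | ht, htD⟩ hst
      · exact hTU s hs hsD t ht htD hst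
      · exact (hZU t ht s hs).symm
      · exact hZU s hs t ht
      · exact hZnbr s hs t ht.1 hst.symm ht.2.1
    have hsub := hW.subset_union (M := D) hTcl hd₀W (mem_compIn_self _ _) (fun h => hd₀ h.1) (by
      intro x hx y hy hxy
      by_cases hyB : y ∈ U ∪ Z
      · exact .inr ⟨hyB, x, hx, hxy⟩
      · exact .inl (mem_compIn_of_adj hd₀B hx ⟨hy, hyB⟩ hxy))
    rcases hsub huW with h | h
    · exact (hDu u h).1 rfl
    · obtain ⟨d, hd, hdu⟩ := h.2
      exact (hDu d hd).2 hdu.symm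
  intro S hSW hS
  refine hholeU S (fun z hzS => ?_) hS
  -- a vertex of `Z` is adjacent to all others
  refine (hWUZ (hSW hzS)).resolve_right fun hz => ?_
  obtain ⟨v, hvS, hvz, hna⟩ := hS.exists_not_adj hzS
  rcases hWUZ (hSW hvS) with h | h
  · exact hna (hZU z hz v h)
  · exact hna (hZnbr z hz v h.1 hvz h.2.1)

/-! ### Vertices of small degree -/

/-- The neighborhood of `v` in the subgraph induced by `W` is a clique, up to one vertex `u` that
can be enlarged to a connected set `A` adjacent to all the others. Thus `v`, its neighbors other
than `u`, and `A` are the branch sets of a complete minor. The choice `u = v`, `A = {v}` covers the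
case of a simplicial vertex. -/
def IsAlmostSimplicial (G : SimpleGraph V) (W : Set V) (v : V) : Prop :=
  ∃ (u : V) (A : Set V), (u = v ∨ u ∈ W ∧ G.Adj v u) ∧ u ∈ A ∧ (∀ a ∈ A, G.ReachIn A u a) ∧
    (∀ a ∈ A, a = v ∨ a ∈ W ∧ G.Adj v a → a = u) ∧
    G.IsClique {w | w ∈ W ∧ G.Adj v w ∧ w ≠ u} ∧
    ∀ w ∈ W, G.Adj v w → w ≠ u → ∃ a ∈ A, G.Adj a w

lemma isAlmostSimplicial_of_isClique {W : Set V} {v : V}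
    (h : G.IsClique {w | w ∈ W ∧ G.Adj v w}) : G.IsAlmostSimplicial W v := by
  refine ⟨v, {v}, .inl rfl, rfl, ?_, fun a ha _ => ha, ?_, fun w _ hvw _ => ⟨v, rfl, hvw⟩⟩
  · rintro a rfl
    exact .refl
  · exact fun a ha b hb => h ⟨ha.1, ha.2.1⟩ ⟨hb.1, hb.2.1⟩

lemma IsNCCover.exists_isAlmostSimplicial_of_noCliqueCutset [Finite V] {C W : Set V}
    (hC : G.IsNCCover C) (hW : G.NoCliqueCutset W) {Q : Set V} (hQ : G.IsClique Q)
    (hne : (W \ Q).Nonempty) : ∃ v ∈ W \ Q, G.IsAlmostSimplicial W v := by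
  obtain ⟨u, huW, hu⟩ : ∃ u ∈ W, ∀ S ⊆ W, G.IsHoleSet S → u ∈ S := by
    by_cases h : ∃ S ⊆ W, G.IsHoleSet S
    · obtain ⟨S, hSW, hS⟩ := h
      exact hC.exists_forall_mem hW hSW hS
    · obtain ⟨u, hu⟩ := hne
      exact ⟨u, hu.1, fun S hSW hS => absurd ⟨S, hSW, hS⟩ h⟩
  by_cases hne' : ((W \ {u}) \ Q).Nonempty
  · obtain ⟨v, ⟨⟨hvW, hvu⟩, hvQ⟩, hv⟩ :=
      exists_simplicial (X := W \ {u})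
        (fun S hSW hS => (hSW (hu S (fun v hv => (hSW hv).1) hS)).2 rfl) hQ hne'
    refine ⟨v, ⟨hvW, hvQ⟩, ?_⟩
    by_cases hvadj : G.Adj v u
    · have hK : G.IsClique (insert v {w | w ∈ W \ {u} ∧ G.Adj v w}) :=
        hv.insert fun b hb _ => hb.2
      set K := insert v {w | w ∈ W \ {u} ∧ G.Adj v w} with hKdef
      have huK : u ∉ K := by
        rintro (h | h)
        exacts [hvu h.symm, h.1.2 rfl]
      refine ⟨u, W \ K, .inr ⟨huW, hvadj⟩, ⟨huW, huK⟩, fun a ha => hW K hK u ⟨huW, huK⟩ a ha, ?_,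
        fun a ha b hb => hv ⟨⟨ha.1, ha.2.2⟩, ha.2.1⟩ ⟨⟨hb.1, hb.2.2⟩, hb.2.1⟩, ?_⟩
      · rintro a ha (rfl | h)
        · exact absurd (.inl rfl) ha.2
        · by_contra hau
          exact ha.2 (.inr ⟨⟨h.1, hau⟩, h.2⟩)
      · -- otherwise the rest of the clique separates `w` from `u`
        intro w hw hvw hwu
        by_contra hno
        push Not at hno
        have hsub := hW.subset_union (M := {w}) (Q := K \ {w}) (m := w)
          (fun a ha b hb => hK ha.1 hb.1) hw rfl (fun h => h.2 rfl) (by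
            rintro x rfl y hy hxy
            refine .inr ⟨?_, hxy.ne'⟩
            by_contra hyK
            exact hno y ⟨hy, hyK⟩ hxy.symm)
        rcases hsub huW with h | h
        exacts [hwu h.symm, huK h.1]
    · refine isAlmostSimplicial_of_isClique fun a ha b hb =>
        hv ⟨⟨ha.1, ?_⟩, ha.2⟩ ⟨⟨hb.1, ?_⟩, hb.2⟩
      · rintro rfl
        exact hvadj ha.2
      · rintro rfl
        exact hvadj hb.2
  · obtain ⟨v, hv⟩ := hne
    have hsub : ∀ w ∈ W, w ≠ u → w ∈ Q := fun w hw hwu => by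
      by_contra h
      exact hne' ⟨w, ⟨hw, hwu⟩, h⟩
    obtain rfl : v = u := by
      by_contra h
      exact hv.2 (hsub v hv.1 h)
    exact ⟨v, hv, isAlmostSimplicial_of_isClique fun a ha b hb =>
      hQ (hsub a ha.1 ha.2.ne') (hsub b hb.1 hb.2.ne')⟩

lemma IsNCCover.exists_isAlmostSimplicial [Finite V] {C W : Set V} (hC : G.IsNCCover C)
    (hne : W.Nonempty) : ∃ v ∈ W, G.IsAlmostSimplicial W v := by
  have := exists_of_noCliqueCutset G.IsAlmostSimplicial ?_ W
    (fun W' _ hW' Q hQ hne => hC.exists_isAlmostSimplicial_of_noCliqueCutset hW' hQ hne)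
    W subset_rfl ∅ (Set.pairwise_empty _) (by simpa using hne)
  · simpa using this
  · rintro W W' v hsub hW' ⟨u, A, h1, h2, h3, h4, h5, h6⟩
    refine ⟨u, A, h1.imp_right fun h => ⟨hsub h.1, h.2⟩, h2, h3,
      fun a ha h => h4 a ha (h.imp_right fun h => ⟨hW' a h.1 h.2, h.2⟩),
      fun a ha b hb => h5 ⟨hW' a ha.1 ha.2.1, ha.2⟩ ⟨hW' b hb.1 hb.2.1, hb.2⟩,
      fun w hw hvw => h6 w (hW' w hw hvw) hvw⟩

lemma IsAlmostSimplicial.ncard_le_cliqueNum [Finite V] {W : Set V} {v : V}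
    (h : G.IsAlmostSimplicial W v) : {w | w ∈ W ∧ G.Adj v w}.ncard ≤ G.cliqueNum := by
  classical
  have := Fintype.ofFinite V
  obtain ⟨u, A, -, -, -, -, hcl, -⟩ := h
  have hK : G.IsClique (insert v {w | w ∈ W ∧ G.Adj v w ∧ w ≠ u}) :=
    hcl.insert fun b hb _ => hb.2.1
  have hle := IsClique.card_le_cliqueNum (G := G)
    (t := (insert v {w | w ∈ W ∧ G.Adj v w ∧ w ≠ u}).toFinset) (tc := by rwa [Set.coe_toFinset])
  rw [← Set.ncard_eq_toFinset_card', Set.ncard_insert_of_notMem (fun h => h.2.1.ne rfl)] at hle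
  refine le_trans ?_ hle
  have : {w | w ∈ W ∧ G.Adj v w} ⊆ insert u {w | w ∈ W ∧ G.Adj v w ∧ w ≠ u} := by
    intro w hw
    by_cases hwu : w = u
    · exact .inl hwu
    · exact .inr ⟨hw.1, hw.2, hwu⟩
  exact (Set.ncard_le_ncard this (Set.toFinite _)).trans (Set.ncard_insert_le _ _)

lemma connected_induce_of_reachIn {A : Set V} {u : V} (hu : u ∈ A)
    (h : ∀ a ∈ A, G.ReachIn A u a) : (G.induce A).Connected := by
  have key : ∀ a, G.ReachIn A u a → ∃ ha : a ∈ A, (G.induce A).Reachable ⟨u, hu⟩ ⟨a, ha⟩ := by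
    intro a hua
    induction hua with
    | refl => exact ⟨hu, .rfl⟩
    | @tail x y _ hxy ih =>
      obtain ⟨hx, hr⟩ := ih
      refine ⟨hxy.2.1, hr.trans (Adj.reachable ?_)⟩
      exact hxy.2.2
  refine (connected_iff_exists_forall_reachable _).2 ⟨⟨u, hu⟩, ?_⟩
  rintro ⟨a, ha⟩
  exact (key a (h a ha)).2

lemma IsAlmostSimplicial.isMinor [Finite V] {W : Set V} {v : V} (h : G.IsAlmostSimplicial W v)
    {n : ℕ} (hn : n ≤ {w | w ∈ W ∧ G.Adj v w}.ncard + 1) :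
    (completeGraph (Fin n)).IsMinor G := by
  classical
  obtain ⟨u, A, hu, huA, hconn, hA, hcl, hadj⟩ := h
  set I : Set V := insert v {w | w ∈ W ∧ G.Adj v w} with hI
  have hIcard : Nat.card (Fin n) ≤ Nat.card I := by
    rw [Nat.card_coe_set_eq, hI, Set.ncard_insert_of_notMem (fun h => h.2.ne rfl)]
    simpa using hn
  obtain ⟨g⟩ : Nonempty (Fin n ↪ I) := by
    have := Fintype.ofFinite I
    refine Function.Embedding.nonempty_of_card_le ?_
    simpa [Nat.card_eq_fintype_card] using hIcard
  have hg : ∀ {a b}, a ≠ b → (g a : V) ≠ g b := fun hab h => hab (g.injective (Subtype.ext h))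
  -- if `i` is not the special vertex `u`, then `A` has a neighbor of `i`
  have hIA : ∀ i ∈ I, i ≠ u → ∃ a ∈ A, G.Adj a i := by
    rintro i (rfl | hi) hiu
    · exact ⟨u, huA, (hu.resolve_left (Ne.symm hiu)).2.symm⟩
    · exact hadj i hi.1 hi.2 hiu
  have hAI : ∀ i ∈ I, i ∈ A → i = u := fun i hi hiA => hA i hiA hi
  refine ⟨fun a => if (g a : V) = u then A else {(g a : V)}, ?_, ?_, ?_⟩
  · intro a
    change (G.induce (if (g a : V) = u then A else {(g a : V)})).Connected
    by_cases h : (g a : V) = u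
    · rw [if_pos h]
      exact connected_induce_of_reachIn huA hconn
    · rw [if_neg h]
      exact connected_induce_of_reachIn rfl (by rintro a rfl; exact .refl)
  · intro a b hab
    by_cases h : (g a : V) = u <;> by_cases h' : (g b : V) = u <;>
      simp only [h, h', if_true, if_false]
    · exact absurd (h.trans h'.symm) (hg hab)
    · exact Set.disjoint_singleton_right.2 fun hbA => h' (hAI _ (g b).2 hbA)
    · exact Set.disjoint_singleton_left.2 fun haA => h (hAI _ (g a).2 haA)
    · exact Set.disjoint_singleton.2 (hg hab)
  · intro a b hab
    have hab : a ≠ b := hab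
    by_cases h : (g a : V) = u <;> by_cases h' : (g b : V) = u <;>
      simp only [h, h', if_true, if_false]
    · exact absurd (h.trans h'.symm) (hg hab)
    · obtain ⟨x, hx, hxb⟩ := hIA _ (g b).2 h'
      exact ⟨x, hx, _, rfl, hxb⟩
    · obtain ⟨x, hx, hxa⟩ := hIA _ (g a).2 h
      exact ⟨_, rfl, x, hx, hxa.symm⟩
    · refine ⟨_, rfl, _, rfl, ?_⟩
      rcases (g a).2 with ha | ha <;> rcases (g b).2 with hb | hb
      · exact absurd (ha.trans hb.symm) (hg hab)
      · exact ha ▸ hb.2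
      · exact hb ▸ ha.2.symm
      · exact hcl ⟨ha.1, ha.2, h⟩ ⟨hb.1, hb.2, h'⟩ (hg hab)

/-! ### DP-coloring of degenerate graphs -/

/-- If each nonempty set `W` has a vertex with fewer than `k` neighbors in `W`, then the vertices
can be colored greedily from lists of size `k`: each neighbor excludes at most one color. -/
lemma dpColorable_of_degenerate [Finite V] {k : ℕ}
    (h : ∀ W : Set V, W.Nonempty → ∃ v ∈ W, {w | w ∈ W ∧ G.Adj v w}.ncard < k) :
    G.DPColorable k := by
  classical
  have := Fintype.ofFinite V
  intro C hC
  have main : ∀ W : Set V, ∃ φ : V → ℕ, (∀ v ∈ W, φ v ∈ C.list v) ∧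
      ∀ u ∈ W, ∀ v ∈ W, ¬ C.Matched u v (φ u) (φ v) := by
    intro W
    induction hcard : W.ncard using Nat.strong_induction_on generalizing W with
    | _ n ih =>
    rcases W.eq_empty_or_nonempty with rfl | hne
    · exact ⟨fun _ => 0, by simp, by simp⟩
    obtain ⟨v, hv, hdeg⟩ := h W hne
    obtain ⟨φ, hφ, hφ'⟩ := ih _ (hcard ▸ Set.ncard_sdiff_singleton_lt_of_mem hv) (W \ {v}) rfl
    let N : Finset V := {w | w ∈ W ∧ G.Adj v w}.toFinset
    let F : Finset ℕ :=
      N.image fun w => if h : ∃ b, C.Matched w v (φ w) b then h.choose else 0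
    have hF : F.card < (C.list v).card := by
      refine lt_of_le_of_lt Finset.card_image_le (lt_of_lt_of_le ?_ (hC v))
      rwa [← Set.ncard_eq_toFinset_card']
    obtain ⟨b, hb, hbF⟩ := Finset.exists_mem_notMem_of_card_lt_card hF
    have hfree : ∀ w ∈ W, ¬ C.Matched w v (φ w) b := by
      intro w hw hm
      refine hbF (Finset.mem_image.2 ⟨w, by simpa [N] using ⟨hw, (C.adj hm).symm⟩, ?_⟩)
      have hex : ∃ b, C.Matched w v (φ w) b := ⟨b, hm⟩
      rw [dif_pos hex]
      exact C.unique hex.choose_spec hm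
    refine ⟨Function.update φ v b, ?_, ?_⟩
    · intro w hw
      by_cases hwv : w = v
      · subst hwv
        simpa using hb
      · simpa [hwv] using hφ w ⟨hw, hwv⟩
    · intro x hx y hy
      by_cases hxv : x = v <;> by_cases hyv : y = v
      · intro hm
        exact (C.adj hm).ne (hxv.trans hyv.symm)
      · subst hxv
        simpa [hyv] using fun hm => hfree y hy (C.symm hm)
      · subst hyv
        simpa [hxv] using hfree x hx
      · simpa [hxv, hyv] using hφ' x ⟨hx, hxv⟩ y ⟨hy, hyv⟩
  obtain ⟨φ, h1, h2⟩ := main Set.univ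
  exact ⟨φ, fun v => h1 v trivial, fun u v _ => h2 u trivial v trivial⟩

lemma DPColorable.dpChromaticNumber_le {k : ℕ} (h : G.DPColorable k) :
    G.dpChromaticNumber ≤ k :=
  iInf₂_le k h

end SimpleGraph

theorem mainTheorem3 {V : Type*} [Finite V] (G : SimpleGraph V) (hG : G.HasNCProperty) :
    G.dpChromaticNumber ≤ ((G.cliqueNum + 1 : ℕ) : ℕ∞) ∧
      ∀ n : ℕ, ¬ (SimpleGraph.completeGraph (Fin n)).IsMinor G →
        G.dpChromaticNumber ≤ ((n - 1 : ℕ) : ℕ∞) := by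
  obtain ⟨C, hC⟩ := hG.exists_isNCCover
  constructor
  · refine (SimpleGraph.dpColorable_of_degenerate fun W hW => ?_).dpChromaticNumber_le
    obtain ⟨v, hv, h⟩ := hC.exists_isAlmostSimplicial hW
    exact ⟨v, hv, Nat.lt_succ_of_le h.ncard_le_cliqueNum⟩
  · intro n hn
    refine (SimpleGraph.dpColorable_of_degenerate fun W hW => ?_).dpChromaticNumber_le
    obtain ⟨v, hv, h⟩ := hC.exists_isAlmostSimplicial hW
    refine ⟨v, hv, ?_⟩
    by_contra hlt
    exact hn (h.isMinor (by omega))
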